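/- A real number $x$ is called lower semi-computable if the set of rational numbers $q<x$ is recursively enumerable (with respect to an effective numbering of $\mathbb{Q}$), and computable if both $x$ and $-x$ are lower semi-computable. A real number $r\in[0,1]$ is called absolutely normal if for every integer $b\ge 2$ its $b$-ary expansion $r_b=(d_0,d_1,d_2,\dots)\in\{0,\dots,b-1\}^{\mathbb{N}}$, with $d_i=\lfloor b^{i+1}r\rfloor \bmod b$, satisfies $$\lim_{n\to\infty}\frac1n\sum_{i=0}^{n-1}1_{[w]}\bigl(\sigma^i(r_b)\bigr)=\frac{1}{b^{|w|}}\qquad\text{for every finite word } w \text{ over } \{0,\dots,b-1\},$$ where $\sigma$ is the shift on sequences, $|w|$ is the length of $w$, and $[w]$ is the set of sequences that begin with $w$. Theorem. The set of computable real numbers in $[0,1]$ which are absolutely normal is dense in $[0,1]$. -/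

import Mathlib

open Filter Topology

/-- `x` is lower semi-computable: the set of rationals below `x` is recursively enumerable.
Rationals are presented effectively as fractions `a / (b + 1)` with `a : ℤ` and `b : ℕ`. -/
def IsLowerSemicomputable (x : ℝ) : Prop :=
  REPred fun p : ℤ × ℕ => (p.1 : ℝ) / ((p.2 : ℝ) + 1) < x

/-- `x` is upper semi-computable: the set of rationals below `-x` is recursively enumerable. -/
def IsUpperSemicomputable (x : ℝ) : Prop :=
  IsLowerSemicomputable (-x)

/-- `x` is a computable real number. -/
def IsComputableReal (x : ℝ) : Prop :=
  IsLowerSemicomputable x ∧ IsUpperSemicomputable x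

/-- The shift on infinite sequences over the alphabet `A`. -/
def seqShift {A : Type*} (s : ℕ → A) : ℕ → A :=
  fun n => s (n + 1)

/-- The cylinder `[w]`: the infinite sequences that begin with the finite word `w`. -/
def wordCylinder {A : Type*} (w : List A) : Set (ℕ → A) :=
  {s | ∀ j : Fin w.length, s j = w.get j}

/-- `r` is normal in base `b`: in its `b`-ary expansion (the digits after the radix point),
every finite word `w` over `{0, …, b - 1}` occurs with asymptotic frequency `1 / b ^ |w|`. -/
def IsNormalInBase (b : ℕ) [NeZero b] (r : ℝ) : Prop :=
  ∀ w : List (Fin b),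
    Tendsto
      (fun n : ℕ => (1 / (n : ℝ)) * ∑ i ∈ Finset.range n,
        (wordCylinder w).indicator (fun _ => (1 : ℝ)) (seqShift^[i] (Real.digits r b)))
      atTop (𝓝 (1 / (b : ℝ) ^ w.length))

/-- `r` is absolutely normal: normal in every base `b ≥ 2`. -/
def IsAbsolutelyNormal (r : ℝ) : Prop :=
  ∀ (b : ℕ) [NeZero b], 2 ≤ b → IsNormalInBase b r

/-! ### Primitive recursive tools -/

/-! The proof is an effective form of Borel's normal number theorem. The interval is divided into
nested grids of `gridSize m` cells. A power of `(m + 2)!` is used so that all digits inspected at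
level `m`, in every base concerned, are constant on a cell. A cell is bad if, for one of the first
`m` word codes, the frequency among the first `n ^ 2` positions is off by at least `1 / m` for some
sample `n` of that level. Occurrences at disjoint positions are uncorrelated, so Chebyshev bounds
the bad proportion for one word and one `n` by a constant depending on `m` over `n ^ 2`. This is
summable, and `sampleStart` grows so fast that for `m ≥ 1` level `m` has bad density at most
`4⁻⁽ᵐ⁺¹⁾` (`count_isBadCell_mul_le`).

Start in any dyadic interval of length `2⁻ᵏ⁰` and bisect, keeping the half with more cells that were
good at all levels above `k₀`. The later bad sets are so small that survivors always fill more than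
half of the chosen interval (`survivorCount_dyadicChoice_ge`). Counting survivors is primitive
recursive, hence so are the choices, and the limit point is computable
(`isComputableReal_of_approx`).

The limit might fall on a boundary of good cells and lie in a bad neighbour. Declaring the last
subcell of every cell bad prevents this (`exists_isComputableReal_forall_not_bad`). A point whose
cells are eventually good has the right frequencies along the squares. Monotonicity of counts
extends this to all lengths (`tendsto_wordCount`). -/

theorem Primrec.nat_pow' : Primrec₂ ((· ^ ·) : ℕ → ℕ → ℕ) :=
  Primrec₂.unpaired'.1 Nat.Primrec.pow

theorem PrimrecRel.exists_lt_comp {α : Type*} [Primcodable α] {p : α → ℕ → Prop} {f : α → ℕ}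
    (hp : PrimrecRel p) (hf : Primrec f) : PrimrecPred fun a => ∃ n < f a, p a n :=
  ((PrimrecRel.exists_mem_list hp.swap).comp (Primrec.list_range.comp hf) Primrec.id).of_eq
    (by simp [Function.swap])

theorem PrimrecRel.forall_lt_comp {α : Type*} [Primcodable α] {p : α → ℕ → Prop} {f : α → ℕ}
    (hp : PrimrecRel p) (hf : Primrec f) : PrimrecPred fun a => ∀ n < f a, p a n :=
  ((PrimrecRel.forall_mem_list hp.swap).comp (Primrec.list_range.comp hf) Primrec.id).of_eq
    (by simp [Function.swap])

theorem Primrec.nat_count {α : Type*} [Primcodable α] {p : α → ℕ → Prop}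
    [∀ a, DecidablePred (p a)] {f : α → ℕ} (hp : PrimrecRel p) (hf : Primrec f) :
    Primrec fun a => Nat.count (p a) (f a) := by
  have h : Primrec₂ fun (a : α) (s : ℕ × ℕ) => s.2 + if p a s.1 then 1 else 0 :=
    Primrec.nat_add.comp (Primrec.snd.comp Primrec.snd)
      (Primrec.ite (hp.comp Primrec.fst (Primrec.fst.comp Primrec.snd))
        (Primrec.const 1) (Primrec.const 0))
  refine (Primrec.nat_rec' hf (Primrec.const 0) h).of_eq fun a => ?_
  induction f a with
  | zero => simp
  | succ n ih => simp [Nat.count_succ, ih]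

theorem Primrec.nat_factorial : Primrec Nat.factorial := by
  have h : Primrec₂ fun n r : ℕ => (n + 1) * r :=
    Primrec.nat_mul.comp (Primrec.succ.comp Primrec.fst) Primrec.snd
  refine (Primrec.nat_rec₁ 1 h).of_eq fun n => ?_
  induction n with
  | zero => rfl
  | succ n ih => simp [Nat.factorial_succ, ← ih]

/-- The parity of the code is the sign, so the positive and negative parts of an integer are
recovered by arithmetic on `ℕ`. -/
theorem Int.encode_eq (z : ℤ) :
    Encodable.encode z = if 0 ≤ z then 2 * z.toNat else 2 * (-z).toNat - 1 := by
  rcases z with n | n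
  · change Nat.bit false n = _
    rw [Nat.bit_val, if_pos (show (0 : ℤ) ≤ Int.ofNat n from Int.natCast_nonneg n)]
    simp
  · change Nat.bit true n = _
    rw [Nat.bit_val, if_neg (Int.negSucc_lt_zero n).not_ge]
    simp only [Int.neg_negSucc, Bool.toNat_true]
    omega

theorem Primrec.int_toNat : Primrec Int.toNat := by
  have h : Primrec fun n : ℕ => if n % 2 = 0 then n / 2 else 0 :=
    Primrec.ite (Primrec.eq.comp (Primrec.nat_mod.comp Primrec.id (Primrec.const 2))
      (Primrec.const 0)) (Primrec.nat_div.comp Primrec.id (Primrec.const 2)) (Primrec.const 0)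
  refine (h.comp Primrec.encode).of_eq fun z => ?_
  rw [Int.encode_eq]
  split_ifs <;> omega

theorem Primrec.int_toNat_neg : Primrec fun z : ℤ => (-z).toNat := by
  have h : Primrec fun n : ℕ => if n % 2 = 0 then 0 else (n + 1) / 2 :=
    Primrec.ite (Primrec.eq.comp (Primrec.nat_mod.comp Primrec.id (Primrec.const 2))
      (Primrec.const 0)) (Primrec.const 0)
      (Primrec.nat_div.comp (Primrec.succ.comp Primrec.id) (Primrec.const 2))
  refine (h.comp Primrec.encode).of_eq fun z => ?_
  rw [Int.encode_eq]
  split_ifs <;> omega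

theorem REPred.exists_of_primrecRel {α : Type*} [Primcodable α] {p : α → ℕ → Prop}
    (hp : PrimrecRel p) : REPred fun a => ∃ n, p a n := by
  classical
  have h : Computable₂ fun a n => decide (p a n) := hp.decide.to_comp
  refine (Partrec.rfind h.partrec₂).dom_re.of_eq fun a => ?_
  simp

/-! ### Computable reals from rational approximations -/

/-- As the gap `1 / d k` tends to `0`, a rational lies below `x` exactly when some `a k / d k`
exceeds it; for `-x` the upper bounds play this role. Splitting the numerator into positive and
negative parts keeps the searched condition inside `ℕ`. -/
theorem isComputableReal_of_approx {x : ℝ} {a d : ℕ → ℕ} (ha : Primrec a) (hd : Primrec d)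
    (hpos : ∀ k, 0 < d k) (hlim : Tendsto d atTop atTop)
    (hle : ∀ k, (a k : ℝ) / d k ≤ x) (hge : ∀ k, x ≤ ((a k : ℝ) + 1) / d k) :
    IsComputableReal x := by
  have hsmall : ∀ ε : ℝ, 0 < ε → ∃ k, 1 / (d k : ℝ) < ε := fun ε hε =>
    ((tendsto_one_div_atTop_nhds_zero_nat.comp hlim).eventually (gt_mem_nhds hε)).exists
  have hcast : ∀ z : ℤ, (z : ℝ) = (z.toNat : ℝ) - ((-z).toNat : ℝ) := fun z => by
    exact_mod_cast (by omega : z = (z.toNat : ℤ) - ((-z).toNat : ℤ))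
  have hz : Primrec fun p : (ℤ × ℕ) × ℕ => p.1.1.toNat * d p.2 :=
    Primrec.nat_mul.comp (Primrec.int_toNat.comp (Primrec.fst.comp Primrec.fst))
      (hd.comp Primrec.snd)
  have hz' : Primrec fun p : (ℤ × ℕ) × ℕ => (-p.1.1).toNat * d p.2 :=
    Primrec.nat_mul.comp (Primrec.int_toNat_neg.comp (Primrec.fst.comp Primrec.fst))
      (hd.comp Primrec.snd)
  have hb : Primrec fun p : (ℤ × ℕ) × ℕ => p.1.2 + 1 :=
    Primrec.succ.comp (Primrec.snd.comp Primrec.fst)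
  have ha' : Primrec fun p : (ℤ × ℕ) × ℕ => a p.2 := ha.comp Primrec.snd
  constructor
  · have h : PrimrecRel fun (p : ℤ × ℕ) (k : ℕ) =>
        p.1.toNat * d k < a k * (p.2 + 1) + (-p.1).toNat * d k :=
      Primrec.nat_lt.comp hz (Primrec.nat_add.comp (Primrec.nat_mul.comp ha' hb) hz')
    refine (REPred.exists_of_primrecRel h).of_eq fun p => ?_
    have key : ∀ k, (p.1.toNat * d k < a k * (p.2 + 1) + (-p.1).toNat * d k) ↔
        (p.1 : ℝ) / ((p.2 : ℝ) + 1) < a k / d k := fun k => by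
      have := hpos k
      rw [div_lt_div_iff₀ (by positivity) (by positivity), hcast, ← Nat.cast_lt (α := ℝ)]
      push_cast
      constructor <;> intro h <;> linarith
    simp only [key]
    constructor
    · rintro ⟨k, hk⟩
      exact hk.trans_le (hle k)
    · intro hx
      obtain ⟨k, hk⟩ := hsmall _ (sub_pos.2 hx)
      refine ⟨k, ?_⟩
      have := hge k
      rw [add_div] at this
      linarith
  · have h : PrimrecRel fun (p : ℤ × ℕ) (k : ℕ) =>
        p.1.toNat * d k + (a k + 1) * (p.2 + 1) < (-p.1).toNat * d k :=
      Primrec.nat_lt.comp (Primrec.nat_add.comp hz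
        (Primrec.nat_mul.comp (Primrec.succ.comp ha') hb)) hz'
    refine (REPred.exists_of_primrecRel h).of_eq fun p => ?_
    have key : ∀ k, (p.1.toNat * d k + (a k + 1) * (p.2 + 1) < (-p.1).toNat * d k) ↔
        (p.1 : ℝ) / ((p.2 : ℝ) + 1) < (-(a k + 1)) / d k := fun k => by
      have := hpos k
      rw [div_lt_div_iff₀ (by positivity) (by positivity), hcast, ← Nat.cast_lt (α := ℝ)]
      push_cast
      constructor <;> intro h <;> linarith
    simp only [key]
    constructor
    · rintro ⟨k, hk⟩
      have := hge k
      rw [neg_div] at hk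
      linarith
    · intro hx
      obtain ⟨k, hk⟩ := hsmall _ (sub_pos.2 hx)
      refine ⟨k, ?_⟩
      have := hle k
      rw [neg_div, add_div]
      linarith

/-! ### Counting lemmas -/

theorem Nat.count_congr {p q : ℕ → Prop} [DecidablePred p] [DecidablePred q] {N : ℕ}
    (h : ∀ j < N, (p j ↔ q j)) : Nat.count p N = Nat.count q N := by
  induction N with
  | zero => simp
  | succ n ih =>
    simp [Nat.count_succ, ih fun j hj => h j (by omega), h n (by omega)]

theorem Nat.count_le_count_add_count {p q s : ℕ → Prop} [DecidablePred p] [DecidablePred q]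
    [DecidablePred s] {N : ℕ} (h : ∀ j < N, p j → q j ∨ s j) :
    Nat.count p N ≤ Nat.count q N + Nat.count s N := by
  induction N with
  | zero => simp
  | succ n ih =>
    have h1 := ih fun j hj => h j (by omega)
    have h2 := h n (by omega)
    simp only [Nat.count_succ]
    split_ifs <;> first | omega | tauto

theorem Nat.count_comp_div (p : ℕ → Prop) [DecidablePred p] {r : ℕ} (hr : 0 < r) (N : ℕ) :
    Nat.count (fun j => p (j / r)) (r * N) = r * Nat.count p N := by
  induction N with
  | zero => simp
  | succ n ih =>
    rw [Nat.mul_succ, Nat.count_add, ih, Nat.count_succ, Nat.mul_add]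
    congr 1
    have : Nat.count (fun k => p ((r * n + k) / r)) r = Nat.count (fun _ => p n) r := by
      refine Nat.count_congr fun k hk => ?_
      rw [Nat.mul_add_div hr, Nat.div_eq_of_lt hk, Nat.add_zero]
    rw [this]
    split_ifs with hp
    · simp [hp]
    · simp [hp]

theorem Nat.count_eq_self {a N : ℕ} (h : a < N) : Nat.count (fun j => j = a) N = 1 := by
  rw [Nat.count_eq_card_filter_range, Finset.filter_eq' (Finset.range N) a]
  simp [h]

/-! ### Computable selection of a point outside small bad sets -/

section Selection

variable (M : ℕ → ℕ) (bad : ℕ → ℕ → Prop) [DecidableRel bad] (k₀ a₀ : ℕ)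

/-- The cell with index `j` of the grid of mesh `1 / M k` lies in the dyadic interval with index `a`
of length `2⁻ᵏ`, and avoids the bad cells of the levels `k₀ + 1, …, k`. -/
def Survives (k a j : ℕ) : Prop :=
  j / (M k / 2 ^ k) = a ∧ ∀ i < k - k₀, ¬ bad (k₀ + i + 1) (j / (M k / M (k₀ + i + 1)))

instance (k a : ℕ) : DecidablePred (Survives M bad k₀ k a) := fun _ =>
  inferInstanceAs (Decidable (_ ∧ _))

/-- The number of surviving cells in the dyadic interval with index `a` of length `2⁻ᵏ`. -/
def survivorCount (k a : ℕ) : ℕ :=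
  Nat.count (Survives M bad k₀ k a) (M k)

/-- Successive bisection, always keeping the half with more surviving cells. -/
def dyadicChoice : ℕ → ℕ
  | 0 => a₀
  | i + 1 =>
    if survivorCount M bad k₀ (k₀ + i + 1) (2 * dyadicChoice i + 1) ≤
        survivorCount M bad k₀ (k₀ + i + 1) (2 * dyadicChoice i)
    then 2 * dyadicChoice i else 2 * dyadicChoice i + 1

variable {M bad k₀ a₀}

theorem primrec_survivorCount (hM : Primrec M) (hbad : PrimrecRel bad) :
    Primrec₂ (survivorCount M bad k₀) := by
  have h2 : Primrec fun k : ℕ => 2 ^ k := Primrec.nat_pow'.comp (Primrec.const 2) Primrec.id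
  have hq : PrimrecRel fun (p : (ℕ × ℕ) × ℕ) (i : ℕ) =>
      ¬ bad (k₀ + i + 1) (p.2 / (M p.1.1 / M (k₀ + i + 1))) := by
    have hi : Primrec fun x : ((ℕ × ℕ) × ℕ) × ℕ => k₀ + x.2 + 1 :=
      Primrec.succ.comp (Primrec.nat_add.comp (Primrec.const k₀) Primrec.snd)
    exact (hbad.comp hi (Primrec.nat_div.comp (Primrec.snd.comp Primrec.fst)
      (Primrec.nat_div.comp (hM.comp (Primrec.fst.comp (Primrec.fst.comp Primrec.fst)))
        (hM.comp hi)))).not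
  have hk : Primrec fun p : (ℕ × ℕ) × ℕ => p.1.1 := Primrec.fst.comp Primrec.fst
  have hs : PrimrecRel fun (p : ℕ × ℕ) (j : ℕ) => Survives M bad k₀ p.1 p.2 j :=
    PrimrecPred.and
      (Primrec.eq.comp (Primrec.nat_div.comp Primrec.snd
        (Primrec.nat_div.comp (hM.comp hk) (h2.comp hk))) (Primrec.snd.comp Primrec.fst))
      (hq.forall_lt_comp (Primrec.nat_sub.comp hk (Primrec.const k₀)))
  exact Primrec.nat_count hs (hM.comp Primrec.fst)

theorem primrec_dyadicChoice (hM : Primrec M) (hbad : PrimrecRel bad) :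
    Primrec (dyadicChoice M bad k₀ a₀) := by
  have hs := primrec_survivorCount (k₀ := k₀) hM hbad
  have hk : Primrec fun p : ℕ × ℕ => k₀ + p.1 + 1 :=
    Primrec.succ.comp (Primrec.nat_add.comp (Primrec.const k₀) Primrec.fst)
  have hl : Primrec fun p : ℕ × ℕ => 2 * p.2 :=
    Primrec.nat_mul.comp (Primrec.const 2) Primrec.snd
  have hr : Primrec fun p : ℕ × ℕ => 2 * p.2 + 1 := Primrec.succ.comp hl
  have h : Primrec₂ fun i a : ℕ =>
      if survivorCount M bad k₀ (k₀ + i + 1) (2 * a + 1) ≤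
        survivorCount M bad k₀ (k₀ + i + 1) (2 * a) then 2 * a else 2 * a + 1 :=
    Primrec.ite (Primrec.nat_le.comp (hs.comp hk hr) (hs.comp hk hl)) hl hr
  refine (Primrec.nat_rec₁ a₀ h).of_eq fun n => ?_
  induction n with
  | zero => rfl
  | succ n ih => simp only [dyadicChoice, ← ih]

theorem dyadicChoice_succ_mem (i : ℕ) :
    2 * dyadicChoice M bad k₀ a₀ i ≤ dyadicChoice M bad k₀ a₀ (i + 1) ∧
      dyadicChoice M bad k₀ a₀ (i + 1) ≤ 2 * dyadicChoice M bad k₀ a₀ i + 1 := by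
  rw [dyadicChoice]
  split_ifs <;> omega

theorem grid_div_mul_div {k m l : ℕ} (hpos : ∀ k, 0 < M k) (h : M m ∣ M k) (hl : M k ∣ M l) :
    M l / M k * (M k / M m) = M l / M m := by
  obtain ⟨c, hc⟩ := h
  obtain ⟨d, hd⟩ := hl
  have hm := hpos m
  rw [hd, Nat.mul_div_cancel_left _ (hpos k), hc, Nat.mul_div_cancel_left _ hm, Nat.mul_assoc,
    Nat.mul_div_cancel_left _ hm, Nat.mul_comm]

/-- Every subcell of a survivor is newly bad or survives in one of the two halves. Since `2 ^ (k +
1)` divides `M (k + 1)`, the halves are unions of cells. -/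
theorem survivorCount_step (hpos : ∀ k, 0 < M k) (hdvd : ∀ k, M k ∣ M (k + 1))
    (htwo : ∀ k, 2 ^ k ∣ M k) {k : ℕ} (hk : k₀ ≤ k) (a : ℕ) :
    M (k + 1) / M k * survivorCount M bad k₀ k a ≤
      survivorCount M bad k₀ (k + 1) (2 * a) + survivorCount M bad k₀ (k + 1) (2 * a + 1) +
        Nat.count (bad (k + 1)) (M (k + 1)) := by
  have hmono : ∀ {m l}, m ≤ l → M m ∣ M l := fun {m l} hml => by
    induction l, hml using Nat.le_induction with
    | base => exact dvd_rfl
    | succ l _ ih => exact ih.trans (hdvd l)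
  obtain ⟨r, hr⟩ := hdvd k
  have hk0 := hpos k
  have hr0 : 0 < r := Nat.pos_of_mul_pos_left (hr ▸ hpos (k + 1))
  have hdiv : M (k + 1) / M k = r := by rw [hr, Nat.mul_div_cancel_left _ hk0]
  have hM : M (k + 1) = r * M k := by rw [hr, mul_comm]
  rw [hdiv, survivorCount, ← Nat.count_comp_div _ hr0, ← hM, survivorCount, survivorCount]
  refine le_trans (Nat.count_le_count_add_count
    (q := fun j => Survives M bad k₀ (k + 1) (2 * a) j ∨ Survives M bad k₀ (k + 1) (2 * a + 1) j)
    (s := bad (k + 1)) ?_)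
    (Nat.add_le_add_right (Nat.count_le_count_add_count fun j _ => id) _)
  rintro j - ⟨hj, hb⟩
  by_cases hbj : bad (k + 1) j
  · exact Or.inr hbj
  left
  obtain ⟨Y, hY⟩ := htwo (k + 1)
  have h1 : r * (M k / 2 ^ k) = 2 * Y := by
    rw [← Nat.mul_div_assoc _ (htwo k), ← hM, hY, pow_succ, mul_assoc,
      Nat.mul_div_cancel_left _ (by positivity)]
  have h2 : M (k + 1) / 2 ^ (k + 1) = Y := by
    rw [hY, Nat.mul_div_cancel_left _ (by positivity)]
  have hcell : j / Y / 2 = a := by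
    rw [Nat.div_div_eq_div_mul, mul_comm Y, ← h1, ← Nat.div_div_eq_div_mul, hj]
  have hrest : ∀ i < k + 1 - k₀,
      ¬ bad (k₀ + i + 1) (j / (M (k + 1) / M (k₀ + i + 1))) := by
    intro i hi
    rcases (show i < k - k₀ ∨ i = k - k₀ by omega) with hi' | rfl
    · have := hb i hi'
      rwa [Nat.div_div_eq_div_mul, ← hdiv,
        grid_div_mul_div hpos (hmono (by omega)) (hdvd k)] at this
    · rw [show k₀ + (k - k₀) + 1 = k + 1 by omega, Nat.div_self (hpos _), Nat.div_one]
      exact hbj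
  simp only [Survives, h2]
  rcases (show j / Y = 2 * a ∨ j / Y = 2 * a + 1 by omega) with h | h
  · exact Or.inl ⟨h, hrest⟩
  · exact Or.inr ⟨h, hrest⟩

theorem survivorCount_start (htwo : ∀ k, 2 ^ k ∣ M k) (hpos : ∀ k, 0 < M k)
    (ha₀ : a₀ < 2 ^ k₀) : survivorCount M bad k₀ k₀ a₀ * 2 ^ k₀ = M k₀ := by
  obtain ⟨Y, hY⟩ := htwo k₀
  have hY0 : 0 < Y := Nat.pos_of_mul_pos_left (hY ▸ hpos k₀)
  have h2 : M k₀ / 2 ^ k₀ = Y := by rw [hY, Nat.mul_div_cancel_left _ (by positivity)]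
  have : survivorCount M bad k₀ k₀ a₀ = Nat.count (fun j => j / Y = a₀) (Y * 2 ^ k₀) := by
    rw [survivorCount, hY, mul_comm Y]
    exact Nat.count_congr fun j _ => by simp [Survives, h2]
  rw [this, Nat.count_comp_div (fun j => j = a₀) hY0, Nat.count_eq_self ha₀, hY]
  ring

/-- The surviving proportion of the chosen interval starts at `1` and loses at most `1 / 2 ^ (i +
2)` at step `i`: relative to an interval of length `2⁻ᵏ`, a bad density of `4⁻⁽ᵏ⁺²⁾` is still that
small. -/
theorem survivorCount_dyadicChoice_ge (hpos : ∀ k, 0 < M k) (hdvd : ∀ k, M k ∣ M (k + 1))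
    (htwo : ∀ k, 2 ^ k ∣ M k)
    (hcount : ∀ k, Nat.count (bad (k + 1)) (M (k + 1)) * 4 ^ (k + 2) ≤ M (k + 1))
    (ha₀ : a₀ < 2 ^ k₀) (i : ℕ) :
    (M (k₀ + i) : ℝ) * (1 / 2 + 1 / 2 ^ (i + 1)) ≤
      survivorCount M bad k₀ (k₀ + i) (dyadicChoice M bad k₀ a₀ i) * 2 ^ (k₀ + i) := by
  induction i with
  | zero =>
    have := survivorCount_start (bad := bad) htwo hpos ha₀
    rw [add_zero, dyadicChoice]
    rw [← @Nat.cast_inj ℝ] at this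
    push_cast at this
    rw [this]
    norm_num
  | succ i ih =>
    set k := k₀ + i with hk
    set a := dyadicChoice M bad k₀ a₀ i
    obtain ⟨r, hr⟩ := hdvd k
    have hstep := survivorCount_step (bad := bad) hpos hdvd htwo (show k₀ ≤ k by omega) a
    rw [hr, Nat.mul_div_cancel_left _ (hpos k), ← hr] at hstep
    have hbest : survivorCount M bad k₀ (k + 1) (2 * a) +
        survivorCount M bad k₀ (k + 1) (2 * a + 1) ≤
        2 * survivorCount M bad k₀ (k + 1) (dyadicChoice M bad k₀ a₀ (i + 1)) := by
      rw [dyadicChoice]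
      split_ifs with h
      · change survivorCount M bad k₀ (k + 1) (2 * a + 1) ≤
          survivorCount M bad k₀ (k + 1) (2 * a) at h
        change _ ≤ 2 * survivorCount M bad k₀ (k + 1) (2 * a)
        omega
      · change ¬ survivorCount M bad k₀ (k + 1) (2 * a + 1) ≤
          survivorCount M bad k₀ (k + 1) (2 * a) at h
        change _ ≤ 2 * survivorCount M bad k₀ (k + 1) (2 * a + 1)
        omega
    change _ ≤ (survivorCount M bad k₀ (k + 1) _ : ℝ) * 2 ^ (k + 1)
    have hcb := hcount k
    change (M (k + 1) : ℝ) * _ ≤ _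
    set S := survivorCount M bad k₀ k a
    set S' := survivorCount M bad k₀ (k + 1) (dyadicChoice M bad k₀ a₀ (i + 1))
    set B := Nat.count (bad (k + 1)) (M (k + 1))
    have h1 : (r : ℝ) * S ≤ 2 * S' + B := by exact_mod_cast hstep.trans (by omega)
    have h2 : (B : ℝ) * 4 ^ (k + 2) ≤ M (k + 1) := by exact_mod_cast hcb
    have h3 : (M (k + 1) : ℝ) = M k * r := by exact_mod_cast hr
    have hp : (0 : ℝ) < 2 ^ k := by positivity
    have h4 : (B : ℝ) * 2 ^ k ≤ M (k + 1) * (1 / 2 ^ (i + 2)) := by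
      have h5 : (B : ℝ) * 2 ^ k * 2 ^ (i + 2) ≤ B * 4 ^ (k + 2) := by
        have : (2 : ℝ) ^ k * 2 ^ (i + 2) ≤ 4 ^ (k + 2) := by
          rw [show (4 : ℝ) = 2 ^ 2 by norm_num, ← pow_mul, ← pow_add]
          exact pow_le_pow_right₀ (by norm_num) (by omega)
        rw [mul_assoc]
        gcongr
      rw [mul_one_div, le_div_iff₀ (by positivity)]
      exact h5.trans h2
    have h6 : (M (k + 1) : ℝ) * (1 / 2 + 1 / 2 ^ (i + 1)) ≤ r * S * 2 ^ k := by
      rw [h3]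
      nlinarith [mul_le_mul_of_nonneg_left ih (Nat.cast_nonneg (α := ℝ) r)]
    have h7 : (1 : ℝ) / 2 ^ (i + 1) = 2 * (1 / 2 ^ (i + 2)) := by
      rw [pow_succ 2 (i + 1)]; field_simp
    rw [h7] at h6
    change (M (k + 1) : ℝ) * (1 / 2 + 1 / 2 ^ (i + 2)) ≤ _
    rw [pow_succ 2 k]
    nlinarith [mul_le_mul_of_nonneg_right h1 hp.le]

theorem exists_survives (hpos : ∀ k, 0 < M k) (hdvd : ∀ k, M k ∣ M (k + 1))
    (htwo : ∀ k, 2 ^ k ∣ M k)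
    (hcount : ∀ k, Nat.count (bad (k + 1)) (M (k + 1)) * 4 ^ (k + 2) ≤ M (k + 1))
    (ha₀ : a₀ < 2 ^ k₀) (i : ℕ) :
    ∃ j, Survives M bad k₀ (k₀ + i) (dyadicChoice M bad k₀ a₀ i) j := by
  by_contra! h
  have hge := survivorCount_dyadicChoice_ge hpos hdvd htwo hcount ha₀ i
  have : survivorCount M bad k₀ (k₀ + i) (dyadicChoice M bad k₀ a₀ i) = 0 := by
    rw [survivorCount, Nat.count_eq_card_filter_range]
    simp [h]
  rw [this, Nat.cast_zero, zero_mul] at hge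
  have hM : (0 : ℝ) < M (k₀ + i) := by exact_mod_cast hpos _
  have : (0 : ℝ) < M (k₀ + i) * (1 / 2 + 1 / 2 ^ (i + 1)) := by positivity
  linarith

/-- Given grids of mesh `1 / M k` and primitive recursive sets of bad cells of small total density
which contain the last cell of every cell of the previous grid, each dyadic interval contains a
computable real all of whose cells are eventually good. -/
theorem exists_isComputableReal_forall_not_bad (hM : Primrec M) (hbad : PrimrecRel bad)
    (hpos : ∀ k, 0 < M k) (hdvd : ∀ k, M k ∣ M (k + 1)) (htwo : ∀ k, 2 ^ k ∣ M k)
    (hcount : ∀ k, Nat.count (bad (k + 1)) (M (k + 1)) * 4 ^ (k + 2) ≤ M (k + 1))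
    (hlast : ∀ k j, j % (M (k + 1) / M k) = M (k + 1) / M k - 1 → bad (k + 1) j)
    (ha₀ : a₀ < 2 ^ k₀) :
    ∃ x : ℝ, (a₀ : ℝ) / 2 ^ k₀ ≤ x ∧ x ≤ ((a₀ : ℝ) + 1) / 2 ^ k₀ ∧ IsComputableReal x ∧
      ∀ m, k₀ < m → ¬ bad m ⌊M m * x⌋₊ := by
  have hmono : ∀ {m l}, m ≤ l → M m ∣ M l := fun {m l} hml => by
    induction l, hml using Nat.le_induction with
    | base => exact dvd_rfl
    | succ l _ ih => exact ih.trans (hdvd l)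
  set a := dyadicChoice M bad k₀ a₀ with ha
  set lo : ℕ → ℝ := fun i => (a i : ℝ) / 2 ^ (k₀ + i) with hlo
  set hi : ℕ → ℝ := fun i => ((a i : ℝ) + 1) / 2 ^ (k₀ + i) with hhi
  have hlo_mono : Monotone lo := monotone_nat_of_le_succ fun i => by
    simp only [hlo, ← add_assoc, pow_succ]
    rw [div_le_div_iff₀ (by positivity) (by positivity)]
    have : (2 * a i : ℝ) ≤ a (i + 1) := by exact_mod_cast (dyadicChoice_succ_mem i).1
    have hp : (0 : ℝ) < 2 ^ (k₀ + i) := by positivity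
    nlinarith
  have hhi_anti : Antitone hi := antitone_nat_of_succ_le fun i => by
    simp only [hhi, ← add_assoc, pow_succ]
    rw [div_le_div_iff₀ (by positivity) (by positivity)]
    have : (a (i + 1) : ℝ) ≤ 2 * a i + 1 := by exact_mod_cast (dyadicChoice_succ_mem i).2
    have hp : (0 : ℝ) < 2 ^ (k₀ + i) := by positivity
    nlinarith
  have hle : lo ≤ hi := fun i => by
    simp only [hlo, hhi]
    gcongr
    linarith
  have hx := hlo_mono.ciSup_mem_iInter_Icc_of_antitone hhi_anti hle
  set x := ⨆ n, lo n
  simp only [Set.mem_iInter, Set.mem_Icc] at hx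
  refine ⟨x, (hx 0).1, (hx 0).2, ?_, ?_⟩
  · refine isComputableReal_of_approx (a := a) (d := fun i => 2 ^ (k₀ + i))
      (primrec_dyadicChoice hM hbad)
      (Primrec.nat_pow'.comp (Primrec.const 2) (Primrec.nat_add.comp (Primrec.const k₀) Primrec.id))
      (fun k => by positivity) ?_ (fun k => ?_) (fun k => ?_)
    · exact tendsto_atTop_mono (fun i => (Nat.lt_two_pow_self (n := i)).le.trans
        (Nat.pow_le_pow_right (by norm_num) (by omega))) tendsto_id
    · simpa [hlo] using (hx k).1
    · simpa [hhi] using (hx k).2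
  · intro m hm
    have hx0 : 0 ≤ x := le_trans (by simp only [hlo]; positivity) (hx 0).1
    set y : ℝ := M (m + 1) * x with hy
    have hy0 : 0 ≤ y := by positivity
    have hgap : 0 < (⌊y⌋₊ : ℝ) + 1 - y := sub_pos.2 (Nat.lt_floor_add_one y)
    -- In units of the mesh `1 / M (m + 1)`, the dyadic interval is shorter than the distance from
    -- `y` to the next integer. A surviving cell in it therefore cannot lie to the right of the cell
    -- of `x`.
    obtain ⟨i, hi_lt, hmi⟩ : ∃ i : ℕ, (M (m + 1) : ℝ) * (1 / 2) ^ (k₀ + i) < ⌊y⌋₊ + 1 - y ∧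
        m + 1 ≤ k₀ + i := by
      have h1 : Tendsto (fun i : ℕ => (M (m + 1) : ℝ) * (1 / 2) ^ (k₀ + i)) atTop (𝓝 0) := by
        have := (tendsto_pow_atTop_nhds_zero_of_lt_one (r := (1 / 2 : ℝ)) (by norm_num)
          (by norm_num)).const_mul (M (m + 1) : ℝ)
        rw [mul_zero] at this
        exact this.comp (tendsto_atTop_mono (fun i => Nat.le_add_left i k₀) tendsto_id)
      obtain ⟨i, h, h'⟩ := ((h1.eventually (gt_mem_nhds hgap)).and
        (eventually_ge_atTop (m + 1))).exists
      exact ⟨i, h, by omega⟩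
    obtain ⟨j, hj, hgood⟩ := exists_survives hpos hdvd htwo hcount ha₀ i
    rw [← ha] at hj
    set k := k₀ + i with hk
    obtain ⟨R, hR⟩ := hmono hmi
    have hM1 := hpos (m + 1)
    have hR0 : 0 < R := Nat.pos_of_mul_pos_left (hR ▸ hpos k)
    have hRdiv : M k / M (m + 1) = R := by rw [hR, Nat.mul_div_cancel_left _ hM1]
    obtain ⟨r, hr⟩ := hdvd m
    have hm0 := hpos m
    have hr0 : 0 < r := Nat.pos_of_mul_pos_left (hr ▸ hM1)
    have hrdiv : M (m + 1) / M m = r := by rw [hr, Nat.mul_div_cancel_left _ hm0]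
    set J := j / R with hJ
    have hJgood : ¬ bad (m + 1) J := by
      have := hgood (m - k₀) (by omega)
      rwa [show k₀ + (m - k₀) + 1 = m + 1 by omega, hRdiv] at this
    have hqgood : ¬ bad m (J / r) := by
      have := hgood (m - k₀ - 1) (by omega)
      rwa [show k₀ + (m - k₀ - 1) + 1 = m by omega, ← grid_div_mul_div hpos (hdvd m) (hmono hmi),
        hRdiv, hrdiv, ← Nat.div_div_eq_div_mul] at this
    -- The cell of `x` will be `J` or `J + 1`; as `J` is not last in its parent, both have the same
    -- parent `J / r`, which is good.
    have hJlast : J % r ≠ r - 1 := fun h => hJgood (hlast m J (by rw [hrdiv, h]))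
    -- the cell `j` lies in the dyadic interval
    obtain ⟨Y, hY⟩ := htwo k
    have hYdiv : M k / 2 ^ k = Y := by rw [hY, Nat.mul_div_cancel_left _ (by positivity)]
    have hY0 : 0 < Y := Nat.pos_of_mul_pos_left (hY ▸ hpos k)
    rw [hYdiv] at hj
    have hj1 : a i * Y ≤ j := by rw [← hj]; exact Nat.div_mul_le_self j Y
    have hj2 : j + 1 ≤ (a i + 1) * Y := by
      rw [← hj]
      have := Nat.lt_div_mul_add (a := j) hY0
      rw [add_mul]; omega
    have hJ1 : J * R ≤ j := Nat.div_mul_le_self j R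
    have hJ2 : j + 1 ≤ (J + 1) * R := by
      have := Nat.lt_div_mul_add (a := j) hR0
      rw [← hJ] at this
      rw [add_mul]; omega
    have hMR : (M (m + 1) : ℝ) * R = 2 ^ k * Y := by exact_mod_cast hR.symm.trans hY
    have hRpos : (0 : ℝ) < R := by exact_mod_cast hR0
    have hYpos : (0 : ℝ) < Y := by exact_mod_cast hY0
    have hp : (0 : ℝ) < 2 ^ k := by positivity
    have hxl : (a i : ℝ) ≤ x * 2 ^ k := by
      have := (hx i).1
      rwa [hlo, div_le_iff₀ hp] at this
    have hxr : x * 2 ^ k ≤ a i + 1 := by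
      have := (hx i).2
      rwa [hhi, le_div_iff₀ hp] at this
    have hMeq : (M (m + 1) : ℝ) = 2 ^ k * Y / R := by rw [← hMR]; field_simp
    have heps : (M (m + 1) : ℝ) * (1 / 2) ^ k = Y / R := by
      rw [hMeq, one_div, inv_pow]; field_simp
    have hyR : y = x * 2 ^ k * (Y / R) := by rw [hy, hMeq]; ring
    have hyl : (J : ℝ) ≤ y + Y / R := by
      have h1 : (J : ℝ) * R ≤ (a i + 1) * Y := by exact_mod_cast hJ1.trans (by omega)
      have h2 : (J : ℝ) ≤ (a i + 1) * (Y / R) := by rw [← mul_div_assoc, le_div_iff₀ hRpos]; exact h1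
      have h3 : (a i : ℝ) * (Y / R) ≤ y := by rw [hyR]; gcongr
      linarith
    have hyr : y ≤ J + 1 + Y / R := by
      have h1 : (a i : ℝ) * Y ≤ (J + 1) * R := by exact_mod_cast hj1.trans (by omega)
      have h2 : (a i : ℝ) * (Y / R) ≤ J + 1 := by rw [← mul_div_assoc, div_le_iff₀ hRpos]; exact h1
      have h3 : y ≤ (a i + 1) * (Y / R) := by rw [hyR]; gcongr
      linarith
    rw [heps] at hi_lt
    have hJy : (J : ℝ) ≤ y := by
      have : (J : ℝ) < (⌊y⌋₊ + 1 : ℕ) := by push_cast; linarith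
      exact (Nat.cast_le.2 (Nat.lt_succ_iff.1 (Nat.cast_lt.1 this))).trans (Nat.floor_le hy0)
    have hyJ : y < J + 2 := by
      have := Nat.floor_le hy0
      linarith
    have hfl : ⌊(M m : ℝ) * x⌋₊ = J / r := by
      have hrpos : (0 : ℝ) < r := by exact_mod_cast hr0
      have hyr' : (M m : ℝ) * x = y / r := by
        rw [hy, hr]; push_cast; field_simp
      rw [hyr', Nat.floor_div_natCast]
      have h1 : J ≤ ⌊y⌋₊ := Nat.le_floor hJy
      have h2 : ⌊y⌋₊ < J + 2 := (Nat.floor_lt hy0).2 (by exact_mod_cast hyJ)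
      rcases (show ⌊y⌋₊ = J ∨ ⌊y⌋₊ = J + 1 by omega) with h | h
      · rw [h]
      · rw [h]
        have h3 := Nat.mod_lt J hr0
        have h4 := Nat.div_add_mod J r
        have h5 : J + 1 = r * (J / r) + (J % r + 1) := by omega
        rw [h5, Nat.mul_add_div hr0, Nat.div_eq_of_lt (show J % r + 1 < r by omega), add_zero]
    rw [hfl]
    exact hqgood

end Selection

/-! ### Second moments of digit frequencies -/

theorem Finset.sum_range_mul_eq {β : Type*} [AddCommMonoid β] (G : ℕ → β) (B A : ℕ) :
    ∑ q ∈ Finset.range (B * A), G q =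
      ∑ u ∈ Finset.range A, ∑ t ∈ Finset.range B, G (B * u + t) := by
  induction A with
  | zero => simp
  | succ n ih => rw [Nat.mul_succ, Finset.sum_range_add, ih, Finset.sum_range_succ]

/-- The normalised indicator of the residue class of `v` modulo `c`. -/
def residueDeviation (c v q : ℕ) : ℤ :=
  (if q % c = v then (c : ℤ) else 0) - 1

theorem residueDeviation_mul_add {c v B : ℕ} (h : c ∣ B) (u t : ℕ) :
    residueDeviation c v (B * u + t) = residueDeviation c v t := by
  obtain ⟨d, rfl⟩ := h
  rw [residueDeviation, mul_assoc, Nat.mul_add_mod, residueDeviation]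

theorem sum_residueDeviation {c v B : ℕ} (hv : v < c) (h : c ∣ B) :
    ∑ t ∈ Finset.range B, residueDeviation c v t = 0 := by
  obtain ⟨d, rfl⟩ := h
  rw [Finset.sum_range_mul_eq]
  refine Finset.sum_eq_zero fun u _ => ?_
  simp only [residueDeviation_mul_add dvd_rfl]
  have : ∀ t ∈ Finset.range c, residueDeviation c v t = (if t = v then (c : ℤ) else 0) - 1 :=
    fun t ht => by rw [residueDeviation, Nat.mod_eq_of_lt (Finset.mem_range.1 ht)]
  rw [Finset.sum_congr rfl this, Finset.sum_sub_distrib, Finset.sum_ite_eq']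
  simp [hv]

theorem abs_residueDeviation_le {c : ℕ} (hc : 0 < c) (v q : ℕ) :
    |residueDeviation c v q| ≤ c := by
  rw [residueDeviation, abs_le]
  split_ifs <;> constructor <;> omega

/-- Digit blocks at disjoint positions are uncorrelated. -/
theorem sum_residueDeviation_mul_eq_zero {b L v M i i' : ℕ} (hb : 0 < b) (hM0 : 0 < M)
    (hv : v < b ^ L) (hM : b ^ (i' + L) ∣ M) (hi : i + L ≤ i') :
    ∑ j ∈ Finset.range M, residueDeviation (b ^ L) v (j * b ^ (i + L) / M) *
      residueDeviation (b ^ L) v (j * b ^ (i' + L) / M) = 0 := by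
  obtain ⟨s, rfl⟩ := hM
  have hs : 0 < s := Nat.pos_of_mul_pos_left hM0
  have h1 : ∀ j, j * b ^ (i' + L) / (b ^ (i' + L) * s) = j / s := fun j => by
    rw [mul_comm j, Nat.mul_div_mul_left _ _ (by positivity)]
  have hpow : b ^ (i' + L) = b ^ (i + L) * b ^ (i' - i) := by
    rw [← pow_add]; congr 1; omega
  have h2 : ∀ j, j * b ^ (i + L) / (b ^ (i' + L) * s) = j / s / b ^ (i' - i) := fun j => by
    rw [hpow, mul_comm j, mul_assoc, Nat.mul_div_mul_left _ _ (by positivity),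
      Nat.div_div_eq_div_mul, mul_comm s]
  simp only [h1, h2]
  -- Write `j / s` as `b ^ (i' - i) * u + w`. The earlier block depends only on `u`, and the later
  -- one only on `w` because `L ≤ i' - i`; its sum over `w` vanishes.
  rw [mul_comm (b ^ (i' + L)) s, Finset.sum_range_mul_eq, hpow, mul_comm (b ^ (i + L)),
    Finset.sum_range_mul_eq]
  refine Finset.sum_eq_zero fun u _ => ?_
  have hB : 0 < b ^ (i' - i) := by positivity
  have h3 : ∀ w ∈ Finset.range (b ^ (i' - i)), ∑ t ∈ Finset.range s,
      residueDeviation (b ^ L) v ((s * (b ^ (i' - i) * u + w) + t) / s / b ^ (i' - i)) *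
        residueDeviation (b ^ L) v ((s * (b ^ (i' - i) * u + w) + t) / s) =
      s * residueDeviation (b ^ L) v u * residueDeviation (b ^ L) v w := fun w hw => by
    have : ∀ t ∈ Finset.range s,
      residueDeviation (b ^ L) v ((s * (b ^ (i' - i) * u + w) + t) / s / b ^ (i' - i)) *
        residueDeviation (b ^ L) v ((s * (b ^ (i' - i) * u + w) + t) / s) =
      residueDeviation (b ^ L) v u * residueDeviation (b ^ L) v w := fun t ht => by
      rw [Nat.mul_add_div hs, Nat.div_eq_of_lt (Finset.mem_range.1 ht), add_zero,
        residueDeviation_mul_add (pow_dvd_pow b (by omega)), Nat.mul_add_div hB,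
        Nat.div_eq_of_lt (Finset.mem_range.1 hw), add_zero]
    rw [Finset.sum_congr rfl this]
    simp [mul_assoc]
  rw [Finset.sum_congr rfl h3, ← Finset.mul_sum,
    sum_residueDeviation hv (pow_dvd_pow b (by omega)), mul_zero]

/-- The number of positions `i < N` at which the base `b` digits of the points of the grid cell
with index `j` and mesh `1 / M` form the word of length `L` with value `v`. -/
def digitCount (b L v N M j : ℕ) : ℕ :=
  Nat.count (fun i => j * b ^ (i + L) / M % b ^ L = v) N

theorem sum_residueDeviation_eq_digitCount (b L v N M j : ℕ) :
    ∑ i ∈ Finset.range N, residueDeviation (b ^ L) v (j * b ^ (i + L) / M) =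
      (b : ℤ) ^ L * digitCount b L v N M j - N := by
  simp only [residueDeviation, digitCount, Finset.sum_sub_distrib, Nat.count_eq_card_filter_range,
    ← Finset.sum_filter]
  simp [mul_comm]

/-- Expanding the square, only pairs of overlapping positions contribute: for each `i` at most `2 *
L` indices `i'`, each with products bounded by `(b ^ L) ^ 2`. -/
theorem sum_digitCount_sq_le {b L v N M : ℕ} (hb : 0 < b) (hM0 : 0 < M)
    (hv : v < b ^ L) (hM : ∀ i < N, b ^ (i + L) ∣ M) :
    ∑ j ∈ Finset.range M, ((b : ℤ) ^ L * digitCount b L v N M j - N) ^ 2 ≤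
      N * (2 * L) * (M * (b ^ L) ^ 2) := by
  set f : ℕ → ℕ → ℤ := fun j i => residueDeviation (b ^ L) v (j * b ^ (i + L) / M) with hf
  have hexp : ∀ j, ((b : ℤ) ^ L * digitCount b L v N M j - N) ^ 2 =
      ∑ i ∈ Finset.range N, ∑ i' ∈ Finset.range N, f j i * f j i' := fun j => by
    rw [← sum_residueDeviation_eq_digitCount, sq, Finset.sum_mul_sum]
  simp only [hexp]
  rw [Finset.sum_comm]
  have hrow : ∀ i ∈ Finset.range N,
      ∑ j ∈ Finset.range M, ∑ i' ∈ Finset.range N, f j i * f j i' ≤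
        (2 * L) * ((M : ℤ) * (b ^ L) ^ 2) := fun i hi => by
    rw [Finset.sum_comm]
    have hpair : ∀ i' ∈ Finset.range N, ∑ j ∈ Finset.range M, f j i * f j i' ≤
        if i' ∈ Finset.Ico (i - L) (i + L) then (M : ℤ) * (b ^ L) ^ 2 else 0 := fun i' hi' => by
      split_ifs with h
      · have : ∀ j ∈ Finset.range M, f j i * f j i' ≤ ((b : ℤ) ^ L) ^ 2 := fun j _ => by
          have hc : 0 < b ^ L := by positivity
          have h1 := abs_residueDeviation_le hc v (j * b ^ (i + L) / M)
          have h2 := abs_residueDeviation_le hc v (j * b ^ (i' + L) / M)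
          calc f j i * f j i' ≤ |f j i| * |f j i'| := by rw [← abs_mul]; exact le_abs_self _
            _ ≤ (b ^ L : ℕ) * (b ^ L : ℕ) := by gcongr
            _ = _ := by push_cast; ring
        simpa using Finset.sum_le_sum this
      · apply le_of_eq
        rw [Finset.mem_Ico, not_and_or, not_le, not_lt] at h
        rcases h with h | h
        · simp only [mul_comm (f _ i)]
          exact sum_residueDeviation_mul_eq_zero hb hM0 hv (hM i (Finset.mem_range.1 hi)) (by omega)
        · exact sum_residueDeviation_mul_eq_zero hb hM0 hv (hM i' (Finset.mem_range.1 hi')) h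
    refine (Finset.sum_le_sum hpair).trans ?_
    rw [← Finset.sum_filter, Finset.sum_const, nsmul_eq_mul]
    have hcard : (Finset.filter (fun i' => i' ∈ Finset.Ico (i - L) (i + L))
        (Finset.range N)).card ≤ 2 * L := by
      calc _ ≤ (Finset.Ico (i - L) (i + L)).card :=
            Finset.card_le_card fun t ht => (Finset.mem_filter.1 ht).2
        _ ≤ 2 * L := by rw [Nat.card_Ico]; omega
    gcongr
    exact_mod_cast hcard
  refine (Finset.sum_le_sum hrow).trans (le_of_eq ?_)
  rw [Finset.sum_const, Finset.card_range, nsmul_eq_mul]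
  ring

/-- The frequency of the word of length `L` with value `v` among the first `N` positions of the cell
with index `j` deviates from `1 / b ^ L` by at least `1 / m`. -/
def DigitDeviates (m b L v N M j : ℕ) : Prop :=
  N * b ^ L ≤ m * (b ^ L * digitCount b L v N M j - N + (N - b ^ L * digitCount b L v N M j))

instance (m b L v N M : ℕ) : DecidablePred (DigitDeviates m b L v N M) := fun _ =>
  inferInstanceAs (Decidable (_ ≤ _))

/-- Of the two truncated differences one is zero, so their sum is the absolute value. The natural
number form is the one shown primitive recursive. -/
theorem digitDeviates_iff {m b L v N M j : ℕ} : DigitDeviates m b L v N M j ↔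
    (N : ℤ) * b ^ L ≤ m * |(b : ℤ) ^ L * digitCount b L v N M j - N| := by
  rw [DigitDeviates, ← Nat.cast_le (α := ℤ)]
  have : ((b ^ L * digitCount b L v N M j - N + (N - b ^ L * digitCount b L v N M j) : ℕ) : ℤ) =
      |(b : ℤ) ^ L * digitCount b L v N M j - N| := by
    have h : (b : ℤ) ^ L * digitCount b L v N M j = (b ^ L * digitCount b L v N M j : ℕ) := by
      push_cast; rfl
    rw [h]
    have := abs_cases (((b ^ L * digitCount b L v N M j : ℕ) : ℤ) - N)
    omega
  rw [← this]
  push_cast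
  rfl

/-- Chebyshev's inequality for digit frequencies. -/
theorem count_digitDeviates_mul_le {m b L v N M : ℕ} (hb : 0 < b) (hM0 : 0 < M) (hN : 0 < N)
    (hv : v < b ^ L) (hM : ∀ i < N, b ^ (i + L) ∣ M) :
    Nat.count (DigitDeviates m b L v N M) M * N ≤ 2 * L * m ^ 2 * M := by
  have h1 : (Nat.count (DigitDeviates m b L v N M) M : ℤ) * ((N : ℤ) * b ^ L) ^ 2 ≤
      m ^ 2 * ∑ j ∈ Finset.range M, ((b : ℤ) ^ L * digitCount b L v N M j - N) ^ 2 := by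
    rw [Nat.count_eq_card_filter_range, Finset.mul_sum, ← nsmul_eq_mul, ← Finset.sum_const]
    refine (Finset.sum_le_sum fun j hj => ?_).trans
      (Finset.sum_le_sum_of_subset_of_nonneg (Finset.filter_subset _ _) fun j _ _ => by positivity)
    have := digitDeviates_iff.1 (Finset.mem_filter.1 hj).2
    calc ((N : ℤ) * b ^ L) ^ 2 ≤ (m * |(b : ℤ) ^ L * digitCount b L v N M j - N|) ^ 2 := by gcongr
      _ = _ := by rw [mul_pow, sq_abs]
  have h2 := h1.trans (mul_le_mul_of_nonneg_left (sum_digitCount_sq_le hb hM0 hv hM)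
    (by positivity))
  have h3 : (0 : ℤ) < N * ((b : ℤ) ^ L) ^ 2 := by positivity
  have h4 : ((Nat.count (DigitDeviates m b L v N M) M * N : ℕ) : ℤ) ≤
      ((2 * L * m ^ 2 * M : ℕ) : ℤ) := by
    refine le_of_mul_le_mul_right ?_ h3
    push_cast
    linarith
  exact_mod_cast h4

/-! ### The bad cells -/

theorem Nat.count_exists_le_sum (s : Finset ℕ) (p : ℕ → ℕ → Prop) [∀ n, DecidablePred (p n)]
    (q : ℕ → Prop) [DecidablePred q] (N : ℕ) (h : ∀ j, q j → ∃ n ∈ s, p n j) :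
    Nat.count q N ≤ ∑ n ∈ s, Nat.count (p n) N := by
  simp only [Nat.count_eq_card_filter_range]
  refine le_trans (Finset.card_le_card fun j hj => ?_) Finset.card_biUnion_le
  obtain ⟨hj, hq⟩ := Finset.mem_filter.1 hj
  obtain ⟨n, hn, hp⟩ := h j hq
  exact Finset.mem_biUnion.2 ⟨n, hn, Finset.mem_filter.2 ⟨hj, hp⟩⟩

/-- The samples of `n ^ 2` digits with `sampleStart m ≤ n < sampleStart (m + 1)` are tested at
level `m`. -/
def sampleStart (m : ℕ) : ℕ := 2 ^ (10 * m + 10)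

/-- The exponent in the size of the grid of level `m`. -/
def gridExponent (m : ℕ) : ℕ := sampleStart (m + 1) ^ 2 + m

/-- The number of cells of level `m`. -/
def gridSize (m : ℕ) : ℕ := (m + 2).factorial ^ gridExponent m

/-- The base of the word with code `e`. -/
def wordBase (e : ℕ) : ℕ := e.unpair.1 + 2

/-- The length of the word with code `e`. -/
def wordLength (e : ℕ) : ℕ := e.unpair.2.unpair.1

/-- The value of the word with code `e`, as a numeral. -/
def wordValue (e : ℕ) : ℕ := e.unpair.2.unpair.2

/-- The cell with index `j` of level `m` has a deviating frequency of the word with code `e` among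
the first `n ^ 2` positions. -/
def WordDeviates (m n e j : ℕ) : Prop :=
  wordValue e < wordBase e ^ wordLength e ∧
    DigitDeviates m (wordBase e) (wordLength e) (wordValue e) (n ^ 2) (gridSize m) j

instance (m n e : ℕ) : DecidablePred (WordDeviates m n e) := fun _ =>
  inferInstanceAs (Decidable (_ ∧ _))

/-- Some word with a small code has a deviating frequency in the cell with index `j`. -/
def HasDeviation (m j : ℕ) : Prop :=
  ∃ n < sampleStart (m + 1), sampleStart m ≤ n ∧ ∃ e < m, WordDeviates m n e j

instance (m : ℕ) : DecidablePred (HasDeviation m) := fun _ =>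
  inferInstanceAs (Decidable (∃ n < _, _))

/-- The cell with index `j` is the last one in its cell of the previous level. -/
def IsLastCell (m j : ℕ) : Prop :=
  j % (gridSize m / gridSize (m - 1)) = gridSize m / gridSize (m - 1) - 1

instance (m : ℕ) : DecidablePred (IsLastCell m) := fun _ =>
  inferInstanceAs (Decidable (_ = _))

/-- The cells to be avoided at level `m`. -/
def IsBadCell (m j : ℕ) : Prop :=
  HasDeviation m j ∨ IsLastCell m j

instance : DecidableRel IsBadCell := fun _ _ =>
  inferInstanceAs (Decidable (_ ∨ _))

theorem primrec_sampleStart : Primrec sampleStart :=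
  Primrec.nat_pow'.comp (Primrec.const 2)
    (Primrec.nat_add.comp (Primrec.nat_mul.comp (Primrec.const 10) Primrec.id) (Primrec.const 10))

theorem primrec_gridSize : Primrec gridSize :=
  Primrec.nat_pow'.comp
    (Primrec.nat_factorial.comp (Primrec.nat_add.comp Primrec.id (Primrec.const 2)))
    (Primrec.nat_add.comp (Primrec.nat_pow'.comp (primrec_sampleStart.comp Primrec.succ)
      (Primrec.const 2)) Primrec.id)

theorem primrec_wordBase : Primrec wordBase :=
  Primrec.nat_add.comp (Primrec.fst.comp Primrec.unpair) (Primrec.const 2)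

theorem primrec_wordLength : Primrec wordLength :=
  Primrec.fst.comp (Primrec.unpair.comp (Primrec.snd.comp Primrec.unpair))

theorem primrec_wordValue : Primrec wordValue :=
  Primrec.snd.comp (Primrec.unpair.comp (Primrec.snd.comp Primrec.unpair))

/-- The word frequency test is primitive recursive in `((m, j), n, e)`. -/
theorem primrecPred_wordDeviates :
    PrimrecPred fun p : ((ℕ × ℕ) × ℕ) × ℕ => WordDeviates p.1.1.1 p.1.2 p.2 p.1.1.2 := by
  have hm : Primrec fun p : ((ℕ × ℕ) × ℕ) × ℕ => p.1.1.1 :=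
    Primrec.fst.comp (Primrec.fst.comp Primrec.fst)
  have hj : Primrec fun p : ((ℕ × ℕ) × ℕ) × ℕ => p.1.1.2 :=
    Primrec.snd.comp (Primrec.fst.comp Primrec.fst)
  have hN : Primrec fun p : ((ℕ × ℕ) × ℕ) × ℕ => p.1.2 ^ 2 :=
    Primrec.nat_pow'.comp (Primrec.snd.comp Primrec.fst) (Primrec.const 2)
  have hb : Primrec fun p : ((ℕ × ℕ) × ℕ) × ℕ => wordBase p.2 :=
    primrec_wordBase.comp Primrec.snd
  have hL : Primrec fun p : ((ℕ × ℕ) × ℕ) × ℕ => wordLength p.2 :=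
    primrec_wordLength.comp Primrec.snd
  have hv : Primrec fun p : ((ℕ × ℕ) × ℕ) × ℕ => wordValue p.2 :=
    primrec_wordValue.comp Primrec.snd
  have hc := Primrec.nat_pow'.comp hb hL
  have hM := primrec_gridSize.comp hm
  have hdigit : PrimrecRel fun (p : ((ℕ × ℕ) × ℕ) × ℕ) (i : ℕ) =>
      p.1.1.2 * wordBase p.2 ^ (i + wordLength p.2) / gridSize p.1.1.1 %
        wordBase p.2 ^ wordLength p.2 = wordValue p.2 :=
    Primrec.eq.comp (Primrec.nat_mod.comp (Primrec.nat_div.comp (Primrec.nat_mul.comp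
      (hj.comp Primrec.fst) (Primrec.nat_pow'.comp (hb.comp Primrec.fst)
        (Primrec.nat_add.comp Primrec.snd (hL.comp Primrec.fst)))) (hM.comp Primrec.fst))
      (hc.comp Primrec.fst)) (hv.comp Primrec.fst)
  have hT := Primrec.nat_mul.comp hc (Primrec.nat_count hdigit hN)
  exact PrimrecPred.and (Primrec.nat_lt.comp hv hc)
    (Primrec.nat_le.comp (Primrec.nat_mul.comp hN hc) (Primrec.nat_mul.comp hm
      (Primrec.nat_add.comp (Primrec.nat_sub.comp hT hN) (Primrec.nat_sub.comp hN hT))))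

theorem primrecRel_isBadCell : PrimrecRel IsBadCell := by
  have h1 : PrimrecRel fun (p : ℕ × ℕ) (n : ℕ) =>
      sampleStart p.1 ≤ n ∧ ∃ e < p.1, WordDeviates p.1 n e p.2 :=
    PrimrecPred.and
      (Primrec.nat_le.comp (primrec_sampleStart.comp (Primrec.fst.comp Primrec.fst)) Primrec.snd)
      (PrimrecRel.exists_lt_comp (p := fun (q : (ℕ × ℕ) × ℕ) e => WordDeviates q.1.1 q.2 e q.1.2)
        primrecPred_wordDeviates (Primrec.fst.comp Primrec.fst))
  have h2 : PrimrecPred fun p : ℕ × ℕ => HasDeviation p.1 p.2 :=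
    h1.exists_lt_comp (primrec_sampleStart.comp (Primrec.succ.comp Primrec.fst))
  have hr : Primrec fun p : ℕ × ℕ => gridSize p.1 / gridSize (p.1 - 1) :=
    Primrec.nat_div.comp (primrec_gridSize.comp Primrec.fst)
      (primrec_gridSize.comp (Primrec.nat_sub.comp Primrec.fst (Primrec.const 1)))
  exact PrimrecPred.or h2 (Primrec.eq.comp (Primrec.nat_mod.comp Primrec.snd hr)
    (Primrec.nat_sub.comp hr (Primrec.const 1)))

theorem gridSize_pos (m : ℕ) : 0 < gridSize m :=
  pow_pos (Nat.factorial_pos _) _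

theorem pow_dvd_gridSize {b m n : ℕ} (hb : 0 < b) (hbm : b ≤ m + 2) (hn : n ≤ gridExponent m) :
    b ^ n ∣ gridSize m :=
  (pow_dvd_pow b hn).trans (pow_dvd_pow_of_dvd (Nat.dvd_factorial hb hbm) _)

/-- The spare factor `2 * 4 ^ (m + 2)` makes the last subcells a sufficiently small fraction of the
next grid. -/
theorem gridSize_mul_dvd (m : ℕ) : gridSize m * 2 ^ (2 * m + 5) ∣ gridSize (m + 1) := by
  have h1 : (m + 2).factorial ∣ (m + 3).factorial := Nat.factorial_dvd_factorial (by omega)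
  have h2 : 2 ∣ (m + 3).factorial := Nat.dvd_factorial (by norm_num) (by omega)
  have h3 : gridExponent m + (2 * m + 5) ≤ gridExponent (m + 1) := by
    have h4 : sampleStart (m + 2) = 1024 * sampleStart (m + 1) := by
      rw [sampleStart, sampleStart, show 10 * (m + 2) + 10 = 10 * (m + 1) + 10 + 10 by ring,
        pow_add _ _ 10]
      ring
    have h5 : 10 * (m + 1) + 10 < sampleStart (m + 1) := Nat.lt_two_pow_self
    simp only [gridExponent, h4]
    nlinarith
  calc gridSize m * 2 ^ (2 * m + 5)
      ∣ (m + 3).factorial ^ gridExponent m * (m + 3).factorial ^ (2 * m + 5) :=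
        mul_dvd_mul (pow_dvd_pow_of_dvd h1 _) (pow_dvd_pow_of_dvd h2 _)
    _ = (m + 3).factorial ^ (gridExponent m + (2 * m + 5)) := (pow_add _ _ _).symm
    _ ∣ gridSize (m + 1) := pow_dvd_pow _ h3

theorem gridSize_dvd_succ (m : ℕ) : gridSize m ∣ gridSize (m + 1) :=
  (Dvd.intro _ rfl).trans (gridSize_mul_dvd m)

theorem two_pow_dvd_gridSize (m : ℕ) : 2 ^ m ∣ gridSize m :=
  pow_dvd_gridSize (by norm_num) (by omega) (Nat.le_add_left _ _)

theorem wordBase_le {e m : ℕ} (h : e < m) : wordBase e ≤ m + 1 := by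
  have := Nat.unpair_left_le e
  rw [wordBase]; omega

theorem wordLength_le (e : ℕ) : wordLength e ≤ e :=
  (Nat.unpair_left_le _).trans (Nat.unpair_right_le _)

/-- This is why a cell determines all the digits tested on it: `gridExponent` leaves `m` further
places beyond the sampled positions, and the word length is at most `e < m`. -/
theorem pow_wordBase_dvd_gridSize {m n e i : ℕ} (hn : n < sampleStart (m + 1)) (he : e < m)
    (hi : i < n ^ 2) : wordBase e ^ (i + wordLength e) ∣ gridSize m := by
  refine pow_dvd_gridSize (by rw [wordBase]; omega) ((wordBase_le he).trans (by omega)) ?_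
  have h1 := wordLength_le e
  have h2 : n ^ 2 ≤ sampleStart (m + 1) ^ 2 := Nat.pow_le_pow_left hn.le 2
  rw [gridExponent]
  omega

theorem count_wordDeviates_le {m n e : ℕ} (hn0 : 0 < n) (hn : n < sampleStart (m + 1))
    (he : e < m) : (Nat.count (WordDeviates m n e) (gridSize m) : ℝ) ≤
      2 * m ^ 3 * gridSize m * ((n : ℝ) ^ 2)⁻¹ := by
  by_cases hv : wordValue e < wordBase e ^ wordLength e
  · have h1 := count_digitDeviates_mul_le (m := m) (b := wordBase e) (L := wordLength e)
      (N := n ^ 2) (by rw [wordBase]; omega) (gridSize_pos m) (by positivity) hv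
      fun i hi => pow_wordBase_dvd_gridSize hn he hi
    have h2 : Nat.count (WordDeviates m n e) (gridSize m) =
        Nat.count (DigitDeviates m (wordBase e) (wordLength e) (wordValue e) (n ^ 2) (gridSize m))
          (gridSize m) := Nat.count_congr fun j _ => and_iff_right hv
    rw [← h2] at h1
    have h3 : 2 * wordLength e * m ^ 2 * gridSize m ≤ 2 * m ^ 3 * gridSize m := by
      have := (wordLength_le e).trans he.le
      calc 2 * wordLength e * m ^ 2 * gridSize m ≤ 2 * m * m ^ 2 * gridSize m := by gcongr
        _ = _ := by ring
    rw [← div_eq_mul_inv, le_div_iff₀ (by positivity)]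
    exact_mod_cast h1.trans h3
  · have : Nat.count (WordDeviates m n e) (gridSize m) = 0 := by
      rw [Nat.count_eq_card_filter_range]
      simp [WordDeviates, hv]
    rw [this, Nat.cast_zero]
    exact mul_nonneg (mul_nonneg (mul_nonneg zero_le_two (pow_nonneg (Nat.cast_nonneg _) _))
      (Nat.cast_nonneg _)) (inv_nonneg.2 (sq_nonneg _))

theorem count_hasDeviation_mul_le (m : ℕ) :
    Nat.count (HasDeviation m) (gridSize m) * (2 * 4 ^ (m + 1)) ≤ gridSize m := by
  have hK : 0 < sampleStart m := by rw [sampleStart]; positivity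
  have h1 : (Nat.count (HasDeviation m) (gridSize m) : ℝ) ≤
      ∑ n ∈ Finset.Ioo (sampleStart m - 1) (sampleStart (m + 1)),
        2 * m ^ 4 * gridSize m * ((n : ℝ) ^ 2)⁻¹ := by
    have h2 : Nat.count (HasDeviation m) (gridSize m) ≤
        ∑ n ∈ Finset.Ioo (sampleStart m - 1) (sampleStart (m + 1)),
          Nat.count (fun j => ∃ e < m, WordDeviates m n e j) (gridSize m) := by
      refine Nat.count_exists_le_sum _ _ _ _ ?_
      rintro j ⟨n, hn, hn', h⟩
      exact ⟨n, Finset.mem_Ioo.2 ⟨by omega, hn⟩, h⟩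
    refine (Nat.cast_le.2 h2).trans ?_
    rw [Nat.cast_sum]
    refine Finset.sum_le_sum fun n hn => ?_
    rw [Finset.mem_Ioo] at hn
    have h3 : Nat.count (fun j => ∃ e < m, WordDeviates m n e j) (gridSize m) ≤
        ∑ e ∈ Finset.range m, Nat.count (WordDeviates m n e) (gridSize m) := by
      refine Nat.count_exists_le_sum _ _ _ _ ?_
      rintro j ⟨e, he, h⟩
      exact ⟨e, Finset.mem_range.2 he, h⟩
    refine (Nat.cast_le.2 h3).trans ?_
    rw [Nat.cast_sum]
    refine (Finset.sum_le_sum fun e he => count_wordDeviates_le (n := n) (by omega) hn.2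
      (Finset.mem_range.1 he)).trans (le_of_eq ?_)
    rw [Finset.sum_const, Finset.card_range, nsmul_eq_mul]
    ring
  rw [← Finset.mul_sum] at h1
  -- The open interval begins one below `sampleStart m`, so that the tail bound is exactly `2 /
  -- sampleStart m`.
  have h4 := sum_Ioo_inv_sq_le (α := ℝ) (sampleStart m - 1) (sampleStart (m + 1))
  rw [Nat.cast_sub hK, Nat.cast_one, sub_add_cancel] at h4
  have h5 := h1.trans (mul_le_mul_of_nonneg_left h4 (by positivity))
  have h6 : 4 * m ^ 4 * (2 * 4 ^ (m + 1)) ≤ sampleStart m := by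
    have h7 : m ^ 4 ≤ (2 ^ m) ^ 4 := Nat.pow_le_pow_left Nat.lt_two_pow_self.le 4
    calc 4 * m ^ 4 * (2 * 4 ^ (m + 1)) ≤ 4 * (2 ^ m) ^ 4 * (2 * 4 ^ (m + 1)) := by gcongr
      _ = 2 ^ (6 * m + 5) := by
        rw [show 4 ^ (m + 1) = (2 ^ 2) ^ (m + 1) by norm_num, ← pow_mul, ← pow_mul,
          show 6 * m + 5 = 2 + m * 4 + (1 + 2 * (m + 1)) by ring, pow_add, pow_add, pow_add]
        ring
      _ ≤ sampleStart m := Nat.pow_le_pow_right (by norm_num) (by omega)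
  have h8 : (0 : ℝ) < sampleStart m := by exact_mod_cast hK
  have h9 : (4 * m ^ 4 * (2 * 4 ^ (m + 1)) : ℝ) ≤ sampleStart m := by exact_mod_cast h6
  have h10 : (Nat.count (HasDeviation m) (gridSize m) : ℝ) * (2 * 4 ^ (m + 1)) ≤ gridSize m := by
    calc (Nat.count (HasDeviation m) (gridSize m) : ℝ) * (2 * 4 ^ (m + 1))
        ≤ 2 * m ^ 4 * gridSize m * (2 / sampleStart m) * (2 * 4 ^ (m + 1)) := by gcongr
      _ = (4 * m ^ 4 * (2 * 4 ^ (m + 1))) / sampleStart m * gridSize m := by ring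
      _ ≤ 1 * gridSize m := by
        gcongr
        exact (div_le_one h8).2 h9
      _ = gridSize m := one_mul _
  exact_mod_cast h10

theorem count_isLastCell_mul_le (k : ℕ) :
    Nat.count (IsLastCell (k + 1)) (gridSize (k + 1)) * (2 * 4 ^ (k + 2)) ≤ gridSize (k + 1) := by
  obtain ⟨r, hr⟩ := gridSize_dvd_succ k
  have hk := gridSize_pos k
  have hr0 : 0 < r := Nat.pos_of_mul_pos_left (hr ▸ gridSize_pos (k + 1))
  have hdiv : gridSize (k + 1) / gridSize k = r := by rw [hr, Nat.mul_div_cancel_left _ hk]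
  have h1 : Nat.count (IsLastCell (k + 1)) (gridSize (k + 1)) = gridSize k := by
    rw [Nat.count_eq_card_filter_range, Finset.card_filter, hr, mul_comm, Finset.sum_range_mul_eq]
    have : ∀ u ∈ Finset.range (gridSize k),
        ∑ t ∈ Finset.range r, (if IsLastCell (k + 1) (r * u + t) then 1 else 0) = 1 := by
      intro u _
      rw [Finset.sum_eq_single (r - 1)]
      · simp [IsLastCell, hdiv, Nat.mod_eq_of_lt (Nat.sub_one_lt hr0.ne')]
      · intro t ht hne
        rw [Finset.mem_range] at ht
        simp [IsLastCell, hdiv, Nat.mod_eq_of_lt ht, hne]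
      · intro h
        exact absurd (Finset.mem_range.2 (Nat.sub_one_lt hr0.ne')) h
    rw [Finset.sum_congr rfl this]
    simp
  rw [h1]
  refine le_of_eq_of_le ?_ (Nat.le_of_dvd (gridSize_pos _) (gridSize_mul_dvd k))
  rw [show 4 ^ (k + 2) = (2 ^ 2) ^ (k + 2) by norm_num, ← pow_mul, ← pow_succ']
  congr 2

theorem count_isBadCell_mul_le (k : ℕ) :
    Nat.count (IsBadCell (k + 1)) (gridSize (k + 1)) * 4 ^ (k + 2) ≤ gridSize (k + 1) := by
  have h1 := count_hasDeviation_mul_le (k + 1)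
  have h2 := count_isLastCell_mul_le k
  have h3 : Nat.count (IsBadCell (k + 1)) (gridSize (k + 1)) ≤ _ :=
    Nat.count_le_count_add_count fun j _ => id
  have h4 := Nat.mul_le_mul_right (4 ^ (k + 2)) h3
  rw [show k + 1 + 1 = k + 2 by ring] at h1
  linarith

/-! ### Normality -/

theorem sampleStart_strictMono : StrictMono sampleStart := fun m n h => by
  rw [sampleStart, sampleStart]
  exact Nat.pow_lt_pow_right (by norm_num) (by omega)

theorem exists_sampleStart_le_lt {m₀ n : ℕ} (h : sampleStart m₀ ≤ n) :
    ∃ m, m₀ ≤ m ∧ sampleStart m ≤ n ∧ n < sampleStart (m + 1) := by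
  have hex : ∃ m, n < sampleStart (m + 1) :=
    ⟨n, (Nat.lt_succ_self n).trans_le sampleStart_strictMono.le_apply⟩
  have h1 := Nat.find_spec hex
  have h2 : m₀ < Nat.find hex + 1 := sampleStart_strictMono.lt_iff_lt.1 (h.trans_lt h1)
  refine ⟨Nat.find hex, by omega, ?_, h1⟩
  by_contra! h3
  rcases Nat.eq_zero_or_pos (Nat.find hex) with h0 | h0
  · rw [h0] at h3 h2
    have : m₀ = 0 := by omega
    subst this
    omega
  · have := Nat.find_min' hex (m := Nat.find hex - 1) (by rwa [Nat.sub_add_cancel h0])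
    omega

/-- With `B` a power of the base, this reads the initial digits of `x` off the index of its grid
cell. -/
theorem floor_mul_div_eq {x : ℝ} {B G : ℕ} (hG : 0 < G) (h : B ∣ G) :
    ⌊(G : ℝ) * x⌋₊ * B / G = ⌊x * B⌋₊ := by
  obtain ⟨s, rfl⟩ := h
  have hB : 0 < B := Nat.pos_of_mul_pos_right hG
  have hs : (s : ℝ) ≠ 0 := Nat.cast_ne_zero.2 (Nat.pos_of_mul_pos_left hG).ne'
  rw [mul_comm _ B, Nat.mul_div_mul_left _ _ hB, ← Nat.floor_div_natCast]
  congr 1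
  push_cast
  field_simp

/-- The number of positions `i < N` at which the base `b` digits of `x` form the word of length `L`
with value `v`. -/
noncomputable def wordCount (b L v : ℕ) (x : ℝ) (N : ℕ) : ℕ :=
  Nat.count (fun i => ⌊x * (b : ℝ) ^ (i + L)⌋₊ % b ^ L = v) N

theorem abs_wordCount_div_sub_lt {x : ℝ} {m n e : ℕ} (hx : ¬ IsBadCell m ⌊gridSize m * x⌋₊)
    (hn : sampleStart m ≤ n) (hn' : n < sampleStart (m + 1)) (he : e < m)
    (hv : wordValue e < wordBase e ^ wordLength e) :
    |(wordCount (wordBase e) (wordLength e) (wordValue e) x (n ^ 2) : ℝ) / (n ^ 2 : ℕ) -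
      1 / (wordBase e : ℝ) ^ wordLength e| < 1 / m := by
  have h1 : ¬ DigitDeviates m (wordBase e) (wordLength e) (wordValue e) (n ^ 2) (gridSize m)
      ⌊gridSize m * x⌋₊ := fun h => hx (Or.inl ⟨n, hn', hn, e, he, hv, h⟩)
  have h2 : digitCount (wordBase e) (wordLength e) (wordValue e) (n ^ 2) (gridSize m)
      ⌊gridSize m * x⌋₊ = wordCount (wordBase e) (wordLength e) (wordValue e) x (n ^ 2) := by
    refine Nat.count_congr fun i hi => ?_
    rw [floor_mul_div_eq (gridSize_pos m) (pow_wordBase_dvd_gridSize hn' he hi)]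
    push_cast
    rfl
  rw [digitDeviates_iff, h2, not_le] at h1
  have hn0 : 0 < n := lt_of_lt_of_le (by rw [sampleStart]; positivity) hn
  clear hn hn' h2 hx
  set T := wordCount (wordBase e) (wordLength e) (wordValue e) x (n ^ 2)
  have h3 : (m : ℝ) * |(wordBase e : ℝ) ^ wordLength e * T - (n ^ 2 : ℕ)| <
      (n ^ 2 : ℕ) * (wordBase e : ℝ) ^ wordLength e := by exact_mod_cast h1
  have hb : (0 : ℝ) < (wordBase e : ℝ) ^ wordLength e := by
    refine pow_pos (Nat.cast_pos.2 ?_) _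
    rw [wordBase]; omega
  have hN : (0 : ℝ) < (n ^ 2 : ℕ) := Nat.cast_pos.2 (pow_pos hn0 2)
  have hm : (0 : ℝ) < m := Nat.cast_pos.2 (by omega)
  set c := (wordBase e : ℝ) ^ wordLength e
  set N : ℝ := ((n ^ 2 : ℕ) : ℝ)
  have h4 : (T : ℝ) / N - 1 / c = (c * T - N) / (N * c) := by field_simp
  rw [h4, abs_div, abs_of_pos (mul_pos hN hb), div_lt_div_iff₀ (mul_pos hN hb) hm]
  linarith

theorem tendsto_wordCount {x : ℝ} {k₀ e : ℕ}
    (hx : ∀ m, k₀ < m → ¬ IsBadCell m ⌊gridSize m * x⌋₊)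
    (hv : wordValue e < wordBase e ^ wordLength e) :
    Tendsto (fun N => (wordCount (wordBase e) (wordLength e) (wordValue e) x N : ℝ) / N) atTop
      (𝓝 (1 / (wordBase e : ℝ) ^ wordLength e)) := by
  refine tendsto_div_of_monotone_of_exists_subseq_tendsto_div
    (fun N => (wordCount (wordBase e) (wordLength e) (wordValue e) x N : ℝ)) _
    (fun M N h => Nat.cast_le.2 (Nat.count_monotone _ h)) fun a ha => ⟨fun n => n ^ 2, ?_, ?_, ?_⟩
  -- For `n ≥ 1`, `(n + 1) ^ 2 ≤ n ^ 2 + 3 * n`, which is at most `a * n ^ 2` once `n ≥ 3 / (a -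
  -- 1)`.
  · obtain ⟨n₀, hn₀⟩ := exists_nat_ge (3 / (a - 1))
    filter_upwards [eventually_ge_atTop (max n₀ 1)] with n hn
    have h1 : (1 : ℝ) ≤ n := by exact_mod_cast (le_max_right _ _).trans hn
    have h2 : (n₀ : ℝ) ≤ n := by exact_mod_cast (le_max_left _ _).trans hn
    have h3 : 3 ≤ (a - 1) * n := by
      rw [mul_comm]
      exact (div_le_iff₀ (sub_pos.2 ha)).1 (hn₀.trans h2)
    push_cast
    nlinarith
  · exact tendsto_pow_atTop two_ne_zero
  · rw [Metric.tendsto_atTop]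
    intro ε hε
    obtain ⟨q, hq⟩ := exists_nat_gt (1 / ε)
    -- The level of `n` then has tolerance below `ε`, lies above `k₀`, and tests the word `e`.
    refine ⟨sampleStart (max q (max (k₀ + 1) (e + 1))), fun n hn => ?_⟩
    obtain ⟨m, hm, hn1, hn2⟩ := exists_sampleStart_le_lt hn
    have hm1 : q ≤ m := (le_max_left _ _).trans hm
    have hm2 : k₀ + 1 ≤ m := ((le_max_left _ _).trans (le_max_right _ _)).trans hm
    have hm3 : e + 1 ≤ m := ((le_max_right _ _).trans (le_max_right _ _)).trans hm
    rw [Real.dist_eq]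
    refine (abs_wordCount_div_sub_lt (hx m hm2) hn1 hn2 hm3 hv).trans ?_
    have hqm : (q : ℝ) ≤ m := Nat.cast_le.2 hm1
    have hm0 : (0 : ℝ) < m := (one_div_pos.2 hε).trans (hq.trans_le hqm)
    exact (one_div_lt hm0 hε).2 (hq.trans_le hqm)

/-! ### Words as base `b` numerals -/

theorem exists_word_value {b : ℕ} (hb : 0 < b) (w : List (Fin b)) :
    ∃ v < b ^ w.length, ∀ q : ℕ,
      (∀ j : Fin w.length, q / b ^ (w.length - 1 - j) % b = w.get j) ↔ q % b ^ w.length = v := by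
  induction w with
  | nil => exact ⟨0, by simp, fun q => by simp [Nat.mod_one]⟩
  | cons d w ih =>
    obtain ⟨v, hv, ih⟩ := ih
    have hd := d.isLt
    -- The first letter is the most significant digit.
    refine ⟨v + b ^ w.length * d, ?_, fun q => ?_⟩
    · rw [List.length_cons, pow_succ]
      nlinarith [Nat.mul_le_mul_left (b ^ w.length) (show (d : ℕ) + 1 ≤ b from hd)]
    · have hp : 0 < b ^ w.length := by positivity
      have hsplit : q % b ^ (w.length + 1) = v + b ^ w.length * d ↔
          q / b ^ w.length % b = d ∧ q % b ^ w.length = v := by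
        rw [pow_succ, Nat.mod_mul]
        constructor
        · intro h
          have h1 := congrArg (· % b ^ w.length) h
          have h2 := congrArg (· / b ^ w.length) h
          simp only [Nat.add_mul_mod_self_left, Nat.mod_mod, Nat.mod_eq_of_lt hv,
            Nat.add_mul_div_left _ _ hp, Nat.div_eq_of_lt hv,
            Nat.div_eq_of_lt (Nat.mod_lt q hp), zero_add] at h1 h2
          exact ⟨h2, h1⟩
        · rintro ⟨h1, h2⟩
          rw [h1, h2]
      simp only [List.length_cons]
      rw [hsplit, ← ih q, Fin.forall_fin_succ]
      simp [Nat.sub_sub, Nat.add_comm]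

theorem iterate_seqShift {A : Type*} (s : ℕ → A) (i n : ℕ) : seqShift^[i] s n = s (i + n) := by
  induction i generalizing s with
  | zero => simp
  | succ i ih =>
    rw [Function.iterate_succ_apply, ih, seqShift]
    congr 1
    omega

theorem iterate_seqShift_digits_mem_iff {b : ℕ} [NeZero b] {w : List (Fin b)} {v : ℕ}
    (hv : ∀ q : ℕ, (∀ j : Fin w.length, q / b ^ (w.length - 1 - j) % b = w.get j) ↔
      q % b ^ w.length = v) (x : ℝ) (i : ℕ) :
    seqShift^[i] (Real.digits x b) ∈ wordCylinder w ↔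
      ⌊x * (b : ℝ) ^ (i + w.length)⌋₊ % b ^ w.length = v := by
  have hb : (b : ℝ) ≠ 0 := Nat.cast_ne_zero.2 (NeZero.ne b)
  rw [← hv]
  refine forall_congr' fun j => ?_
  rw [iterate_seqShift, Fin.ext_iff, Real.digits, Fin.val_ofNat, ← Nat.floor_div_natCast]
  have : x * (b : ℝ) ^ (i + w.length) / ((b ^ (w.length - 1 - j) : ℕ) : ℝ) =
      x * (b : ℝ) ^ (i + j + 1) := by
    have h : i + w.length = (i + j + 1) + (w.length - 1 - j) := by omega
    rw [Nat.cast_pow, h, pow_add, ← mul_assoc, mul_div_cancel_right₀ _ (pow_ne_zero _ hb)]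
  rw [this]

theorem isAbsolutelyNormal_of_forall_not_isBadCell {x : ℝ} {k₀ : ℕ}
    (hx : ∀ m, k₀ < m → ¬ IsBadCell m ⌊gridSize m * x⌋₊) : IsAbsolutelyNormal x := by
  intro b _ hb w
  obtain ⟨v, hvlt, hv⟩ := exists_word_value (by omega : 0 < b) w
  set e := Nat.pair (b - 2) (Nat.pair w.length v) with he
  have h1 : wordBase e = b := by rw [wordBase, he, Nat.unpair_pair]; dsimp only; omega
  have h2 : wordLength e = w.length := by simp [wordLength, he]
  have h3 : wordValue e = v := by simp [wordValue, he]
  have h := tendsto_wordCount (e := e) hx (by rwa [h1, h2, h3])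
  rw [h1, h2, h3] at h
  refine h.congr fun n => ?_
  classical
  rw [wordCount, Nat.count_eq_card_filter_range, Finset.card_filter, one_div, ← div_eq_inv_mul]
  push_cast
  congr 1
  refine Finset.sum_congr rfl fun i _ => ?_
  rw [Set.indicator_apply]
  exact if_congr (iterate_seqShift_digits_mem_iff hv x i).symm rfl rfl

/-! ### Density -/

theorem exists_isComputableReal_isAbsolutelyNormal {k₀ a₀ : ℕ} (ha₀ : a₀ < 2 ^ k₀) :
    ∃ x : ℝ, (a₀ : ℝ) / 2 ^ k₀ ≤ x ∧ x ≤ ((a₀ : ℝ) + 1) / 2 ^ k₀ ∧ IsComputableReal x ∧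
      IsAbsolutelyNormal x := by
  obtain ⟨x, h1, h2, h3, h4⟩ := exists_isComputableReal_forall_not_bad primrec_gridSize
    primrecRel_isBadCell gridSize_pos gridSize_dvd_succ two_pow_dvd_gridSize
    count_isBadCell_mul_le (fun k j h => Or.inr h) ha₀
  exact ⟨x, h1, h2, h3, isAbsolutelyNormal_of_forall_not_isBadCell h4⟩

theorem exists_dyadic_near {y ε : ℝ} (hy : y ∈ Set.Icc (0 : ℝ) 1) (hε : 0 < ε) :
    ∃ k a : ℕ, a < 2 ^ k ∧ y - ε < (a : ℝ) / 2 ^ k ∧ ((a : ℝ) + 1) / 2 ^ k < y + ε := by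
  obtain ⟨k, hk⟩ := exists_pow_lt_of_lt_one hε (show (1 / 2 : ℝ) < 1 by norm_num)
  have hp : (0 : ℝ) < 2 ^ k := by positivity
  rw [one_div, inv_pow, inv_lt_iff_one_lt_mul₀ hp] at hk
  rcases hy.2.lt_or_eq with h | rfl
  · have h0 : 0 ≤ y * 2 ^ k := mul_nonneg hy.1 hp.le
    have h1 := Nat.floor_le h0
    have h2 := Nat.lt_floor_add_one (y * 2 ^ k)
    refine ⟨k, ⌊y * 2 ^ k⌋₊, (Nat.floor_lt h0).2 ?_, ?_, ?_⟩
    · push_cast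
      nlinarith
    · rw [lt_div_iff₀ hp]
      nlinarith
    · rw [div_lt_iff₀ hp]
      nlinarith
  -- At `y = 1` the floor would give the index `2 ^ k`, outside the unit interval, so the last
  -- dyadic interval is taken.
  · have h1 : 1 ≤ 2 ^ k := Nat.one_le_two_pow
    refine ⟨k, 2 ^ k - 1, by omega, ?_, ?_⟩
    · rw [Nat.cast_sub h1, lt_div_iff₀ hp]
      push_cast
      nlinarith
    · rw [Nat.cast_sub h1, div_lt_iff₀ hp]
      push_cast
      nlinarith

theorem mainTheorem4 :
    Dense {x : Set.Icc (0 : ℝ) 1 | IsComputableReal (x : ℝ) ∧ IsAbsolutelyNormal (x : ℝ)} := by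
  rw [Metric.dense_iff]
  intro y ε hε
  obtain ⟨k, a, ha, h1, h2⟩ := exists_dyadic_near y.2 hε
  obtain ⟨x, hx1, hx2, hc, hn⟩ := exists_isComputableReal_isAbsolutelyNormal ha
  have hx0 : 0 ≤ x := le_trans (by positivity) hx1
  have hx3 : x ≤ 1 := hx2.trans <| by
    rw [div_le_one (by positivity)]
    exact_mod_cast ha
  refine ⟨⟨x, hx0, hx3⟩, ?_, hc, hn⟩
  rw [Metric.mem_ball, Subtype.dist_eq, Real.dist_eq, abs_lt]
  constructor <;> dsimp only <;> linarith
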